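/- Let $\kappa\ge 1$, $n=2^\kappa-1$ and $k=n-\kappa$. An $(n,\kappa)$ coset code consists of a $\kappa\times n$ matrix $G$ and a $k\times n$ matrix $G'$ over $\mathbb F_2$ whose rows together are linearly independent. A uniformly distributed message $M\in\mathbb F_2^k$ is encoded as $X=MG'+M'G$ with $M'\in\mathbb F_2^\kappa$ uniform and independent of $M$. The eavesdropper observes the output $Z\in\{0,1,?\}^n$ of a memoryless binary erasure channel with input $X$ and erasure probability $\epsilon$ (the binary erasure wiretap channel). Write $$\lambda(\epsilon)=\sum_{m,z}\Big(\frac{p_{MZ}(m,z)}{p_M(m)p_Z(z)}-1\Big)^2p_M(m)p_Z(z)$$ for the $\chi^2$ divergence between $p_{MZ}$ and $p_Mp_Z$ (terms with $p_M(m)p_Z(z)=0$ are $0$). The code is a simplex code if every nonzero vector of $\mathbb F_2^\kappa$ makes up the fraction $1/(2^\kappa-1)$ of the columns of $G$ (so occurs exactly once as a column) and the zero column does not occur. Then $(n,\kappa)$ coset codes that are simplex codes exist, and simplex codes are optimal for their size with respect to maximum likelihood (ML) eavesdropper decoding: for every simplex code $S$, every $(n,\kappa)$ coset code $C$ and every $\epsilon\in[0,1]$,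 we have $\lambda_S(\epsilon)\le\lambda_C(\epsilon)$, and the probability that an ML decoder of the eavesdropper (any decoder $d$ with $p(z\mid d(z))=\max_m p(z\mid m)$ for all $z$) recovers the message from $Z$ is at most as large for $S$ as for $C$. -/

import Mathlib

namespace BEWC

/-- Binary vectors of length `n`, i.e. elements of `𝔽₂ⁿ`. -/
abbrev Bits (n : ℕ) : Type := Fin n → ZMod 2

/-- The eavesdropper's observations: words of length `n` over `{0, 1, ?}`, with `none` the
erasure symbol `?`. -/
abbrev Obs (n : ℕ) : Type := Fin n → Option (ZMod 2)

/-- A coset code of blocklength `n` whose base code has dimension `κ`; the message has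
`k = n - κ` bits. The rows of `G'` and `G` together are linearly independent; in particular `G`
has full rank and `κ ≤ n`. -/
structure CosetCode (n κ : ℕ) where
  /-- generator matrix of the base code -/
  G : Matrix (Fin κ) (Fin n) (ZMod 2)
  /-- auxiliary generator matrix -/
  G' : Matrix (Fin (n - κ)) (Fin n) (ZMod 2)
  linInd : LinearIndependent (ZMod 2) (Matrix.fromRows G' G).row

/-- Transition probability `p(z | x)` of `n` uses of the binary erasure channel with erasure
probability `ε`. -/
noncomputable def bec {n : ℕ} (ε : ℝ) (x : Bits n) (z : Obs n) : ℝ :=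
  ∏ j, if z j = none then ε else if z j = some (x j) then 1 - ε else 0

/-- The `χ²` divergence `∑ (p / q - 1)² q` of two mass functions on a finite set. (Points with
`q = 0` contribute `0`.) -/
noncomputable def chiSqDiv {α : Type*} [Fintype α] (p q : α → ℝ) : ℝ :=
  ∑ a, (p a / q a - 1) ^ 2 * q a

/-- The code definition vector with uniform values: entry `1 / (2 ^ κ - 1)` at every nonzero
vector, and `0` at the zero vector. -/
noncomputable def uniformVectorFraction (κ : ℕ) (v : Bits κ) : ℝ :=
  if v = 0 then 0 else 1 / (2 ^ κ - 1)

namespace CosetCode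

variable {n κ : ℕ}

/-- The codeword `x = [m m'] [G'; G]`. -/
def encode (C : CosetCode n κ) (m : Bits (n - κ)) (m' : Bits κ) : Bits n :=
  Matrix.vecMul (Sum.elim m m') (Matrix.fromRows C.G' C.G)

/-- The likelihood `p(z | m)`: the auxiliary message `m'` is uniform on `κ` bits and the codeword
is sent through the erasure channel. -/
noncomputable def likelihood (C : CosetCode n κ) (ε : ℝ) (m : Bits (n - κ)) (z : Obs n) : ℝ :=
  ∑ m' : Bits κ, (1 / 2 ^ κ : ℝ) * bec ε (C.encode m m') z

/-- The joint mass function `p_{MZ}` of the uniform message `M` and the observation `Z`. -/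
noncomputable def pMZ (C : CosetCode n κ) (ε : ℝ) (w : Bits (n - κ) × Obs n) : ℝ :=
  (1 / 2 ^ (n - κ) : ℝ) * C.likelihood ε w.1 w.2

/-- The marginal mass function of the message. -/
noncomputable def pM (C : CosetCode n κ) (ε : ℝ) (m : Bits (n - κ)) : ℝ :=
  ∑ z : Obs n, C.pMZ ε (m, z)

/-- The marginal mass function of the observation. -/
noncomputable def pZ (C : CosetCode n κ) (ε : ℝ) (z : Obs n) : ℝ :=
  ∑ m : Bits (n - κ), C.pMZ ε (m, z)

/-- The `χ²` divergence between `p_{MZ}` and `p_M p_Z`. -/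
noncomputable def chiSq (C : CosetCode n κ) (ε : ℝ) : ℝ :=
  chiSqDiv (C.pMZ ε) (fun w => C.pM ε w.1 * C.pZ ε w.2)

/-- `d` is a maximum likelihood decoder for the eavesdropper. -/
def IsMLDecoder (C : CosetCode n κ) (ε : ℝ) (d : Obs n → Bits (n - κ)) : Prop :=
  ∀ z m, C.likelihood ε m z ≤ C.likelihood ε (d z) z

/-- The probability `Pr[d(Z) = M]` that the decoder `d` recovers the message. -/
noncomputable def successProb (C : CosetCode n κ) (ε : ℝ) (d : Obs n → Bits (n - κ)) : ℝ :=
  ∑ z, C.pMZ ε (d z, z)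

/-- The code definition vector: the fraction of columns of `G` that are equal to `v`. -/
noncomputable def codeVector (C : CosetCode n κ) (v : Bits κ) : ℝ :=
  ((Finset.univ.filter fun j : Fin n => C.G.col j = v).card : ℝ) / n

/-- The base code is the simplex code: `n = 2 ^ κ - 1` and all nonzero columns occur in `G` in
equal proportion (so each exactly once). -/
def IsSimplex (C : CosetCode n κ) : Prop :=
  n = 2 ^ κ - 1 ∧ C.codeVector = uniformVectorFraction κ

end CosetCode

end BEWC

/-! Given `z`, the words `M'` compatible with a message form the empty set or a coset of those `u`
whose codeword `uG` vanishes at the unerased positions. So the likelihood is either `0` or a value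
depending on `z` alone, and the latter is attained. Hence the ML success probability
(`successProb_eq`) and the χ² divergence (`chiSq_eq`) are increasing affine functions of one number,
`leakage`. Summing over `z` position by position turns it into a positive multiple of `∑ u, a ^
weight u` with `a = ε / (2 - ε)` in `[0, 1]` (`leakage_eq`). The total weight is at most `n * 2 ^ (κ
- 1)`, and a simplex code attains this with all nonzero words of equal weight. As `w ↦ a ^ w` is
convex and decreasing, equal weights with maximal total minimize the sum (`sum_pow_weight_le`). -/

namespace BEWC

namespace CosetCode

variable {n κ : ℕ}

/-! ### Two-valued likelihoods. -/

/-- The word `x` is compatible with the observation `z`. -/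
def Agrees (x : Bits n) (z : Obs n) : Prop := ∀ j, z j = none ∨ z j = some (x j)

/-- The total channel weight of the base codewords on the all-zero observation with the erasure
pattern of `z`. -/
noncomputable def baseWeight (C : CosetCode n κ) (ε : ℝ) (z : Obs n) : ℝ :=
  ∑ u : Bits κ, ∏ j, if z j = none then ε else
    if Matrix.vecMul u C.G j = 0 then 1 - ε else 0

lemma encode_eq (C : CosetCode n κ) (m : Bits (n - κ)) (m' : Bits κ) :
    C.encode m m' = Matrix.vecMul m C.G' + Matrix.vecMul m' C.G := by
  simp [encode]

lemma le_blocklength (C : CosetCode n κ) : κ ≤ n := by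
  have h := C.linInd.fintype_card_le_finrank
  simp only [Fintype.card_sum, Fintype.card_fin, Module.finrank_fin_fun] at h
  omega

lemma encode_surjective (C : CosetCode n κ) (x : Bits n) : ∃ m m', C.encode m m' = x := by
  have hcard : Fintype.card (Fin (n - κ) ⊕ Fin κ) = Module.finrank (ZMod 2) (Bits n) := by
    have := C.le_blocklength
    simp only [Fintype.card_sum, Fintype.card_fin, Module.finrank_fin_fun]
    omega
  have hspan := C.linInd.span_eq_top_of_card_eq_finrank' hcard
  have hx : x ∈ Submodule.span (ZMod 2) (Set.range (Matrix.fromRows C.G' C.G).row) := by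
    rw [hspan]; trivial
  obtain ⟨c, hc⟩ := (Submodule.mem_span_range_iff_exists_fun _).1 hx
  refine ⟨fun i => c (Sum.inl i), fun i => c (Sum.inr i), ?_⟩
  have : Sum.elim (fun i => c (Sum.inl i)) (fun i => c (Sum.inr i)) = c := by
    ext i; cases i <;> rfl
  rw [encode, this, ← hc, Matrix.vecMul_eq_sum]
  rfl

lemma bec_eq_zero {ε : ℝ} {x : Bits n} {z : Obs n} (h : ¬ Agrees x z) : bec ε x z = 0 := by
  simp only [Agrees, not_forall, not_or] at h
  obtain ⟨j, h1, h2⟩ := h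
  exact Finset.prod_eq_zero (Finset.mem_univ j) (by simp [h1, h2])

lemma bec_nonneg {ε : ℝ} (h0 : 0 ≤ ε) (h1 : ε ≤ 1) (x : Bits n) (z : Obs n) : 0 ≤ bec ε x z := by
  refine Finset.prod_nonneg fun j _ => ?_
  split_ifs <;> linarith

lemma sum_bec (ε : ℝ) (x : Bits n) : ∑ z, bec ε x z = 1 := by
  have := (Finset.prod_univ_sum (fun _ : Fin n => (Finset.univ : Finset (Option (ZMod 2))))
    (fun j o => if o = none then ε else if o = some (x j) then 1 - ε else 0)).symm
  rw [Fintype.piFinset_univ] at this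
  unfold bec
  rw [this]
  refine Finset.prod_eq_one fun j _ => ?_
  rw [Fintype.sum_option]
  simp

/-- Translating the auxiliary message by `m₀` reduces to the all-zero observation. -/
lemma likelihood_of_agrees (C : CosetCode n κ) (ε : ℝ) {m : Bits (n - κ)} {z : Obs n}
    {m₀ : Bits κ} (h : Agrees (C.encode m m₀) z) :
    C.likelihood ε m z = 1 / 2 ^ κ * C.baseWeight ε z := by
  rw [likelihood, ← Finset.mul_sum, baseWeight, ← Equiv.sum_comp (Equiv.addLeft m₀)]
  congr 1
  refine Finset.sum_congr rfl fun u _ => Finset.prod_congr rfl fun j _ => ?_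
  rcases h j with hj | hj
  · simp [hj]
  · simp only [encode_eq] at hj
    simp [hj, encode_eq, Matrix.add_vecMul]

lemma likelihood_eq_zero_or (C : CosetCode n κ) (ε : ℝ) (m : Bits (n - κ)) (z : Obs n) :
    C.likelihood ε m z = 0 ∨ C.likelihood ε m z = 1 / 2 ^ κ * C.baseWeight ε z := by
  by_cases h : ∃ m₀, Agrees (C.encode m m₀) z
  · exact Or.inr (C.likelihood_of_agrees ε h.choose_spec)
  · push Not at h
    exact Or.inl (Finset.sum_eq_zero fun u _ => by rw [bec_eq_zero (h u), mul_zero])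

lemma exists_likelihood_eq (C : CosetCode n κ) (ε : ℝ) (z : Obs n) :
    ∃ m, C.likelihood ε m z = 1 / 2 ^ κ * C.baseWeight ε z := by
  -- Any filling of the erasures will do; here they become `0`.
  obtain ⟨m, m₀, h⟩ := C.encode_surjective fun j => (z j).getD 0
  refine ⟨m, C.likelihood_of_agrees ε (m₀ := m₀) fun j => ?_⟩
  rw [h]
  dsimp only
  cases z j <;> simp

lemma likelihood_nonneg (C : CosetCode n κ) {ε : ℝ} (h0 : 0 ≤ ε) (h1 : ε ≤ 1)
    (m : Bits (n - κ)) (z : Obs n) : 0 ≤ C.likelihood ε m z :=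
  Finset.sum_nonneg fun _ _ => mul_nonneg (by positivity) (bec_nonneg h0 h1 _ _)

lemma baseWeight_nonneg (C : CosetCode n κ) {ε : ℝ} (h0 : 0 ≤ ε) (h1 : ε ≤ 1) (z : Obs n) :
    0 ≤ C.baseWeight ε z := by
  refine Finset.sum_nonneg fun u _ => Finset.prod_nonneg fun j _ => ?_
  split_ifs <;> linarith

lemma sum_likelihood (C : CosetCode n κ) (ε : ℝ) (m : Bits (n - κ)) :
    ∑ z, C.likelihood ε m z = 1 := by
  simp only [likelihood]
  rw [Finset.sum_comm]
  simp [← Finset.mul_sum, sum_bec]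

lemma pM_eq (C : CosetCode n κ) (ε : ℝ) (m : Bits (n - κ)) :
    C.pM ε m = 1 / 2 ^ (n - κ) := by
  simp [pM, pMZ, ← Finset.mul_sum, sum_likelihood]

lemma sum_pZ (C : CosetCode n κ) (ε : ℝ) : ∑ z, C.pZ ε z = 1 := by
  have h : ∑ m, C.pM ε m = 1 := by simp [pM_eq]
  rw [← h]
  simp only [pM, pZ]
  exact Finset.sum_comm

lemma pMZ_nonneg (C : CosetCode n κ) {ε : ℝ} (h0 : 0 ≤ ε) (h1 : ε ≤ 1)
    (w : Bits (n - κ) × Obs n) : 0 ≤ C.pMZ ε w :=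
  mul_nonneg (by positivity) (C.likelihood_nonneg h0 h1 _ _)

/-! ### Reduction to the weight distribution. -/

/-- The normalized total of `baseWeight` over all observations, which determines both the `χ²`
divergence and the success probability of maximum likelihood decoding. -/
noncomputable def leakage (C : CosetCode n κ) (ε : ℝ) : ℝ :=
  1 / 2 ^ κ * ∑ z, C.baseWeight ε z

lemma successProb_eq (C : CosetCode n κ) {ε : ℝ} (h0 : 0 ≤ ε) (h1 : ε ≤ 1)
    {d : Obs n → Bits (n - κ)} (hd : C.IsMLDecoder ε d) :
    C.successProb ε d = 1 / 2 ^ (n - κ) * C.leakage ε := by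
  have key : ∀ z, C.likelihood ε (d z) z = 1 / 2 ^ κ * C.baseWeight ε z := fun z => by
    obtain ⟨m, hm⟩ := C.exists_likelihood_eq ε z
    have h := hd z m
    rcases C.likelihood_eq_zero_or ε (d z) z with h' | h'
    · have : 0 ≤ 1 / 2 ^ κ * C.baseWeight ε z :=
        mul_nonneg (by positivity) (C.baseWeight_nonneg h0 h1 z)
      linarith
    · exact h'
  simp only [successProb, pMZ, key, leakage, Finset.mul_sum]

/-- With likelihood `L` in `{0, B}` one has `L ^ 2 = L * B`, so the square expands to terms linear
in `L`. -/
lemma sum_chiSq_term (C : CosetCode n κ) {ε : ℝ} (h0 : 0 ≤ ε) (h1 : ε ≤ 1) (z : Obs n) :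
    ∑ m, (C.pMZ ε (m, z) / (C.pM ε m * C.pZ ε z) - 1) ^ 2 * (C.pM ε m * C.pZ ε z) =
      1 / 2 ^ κ * C.baseWeight ε z - C.pZ ε z := by
  by_cases hz : C.pZ ε z = 0
  · obtain ⟨m, hm⟩ := C.exists_likelihood_eq ε z
    have h := (Finset.sum_eq_zero_iff_of_nonneg
      (fun m _ => C.pMZ_nonneg h0 h1 (m, z))).1 hz m (Finset.mem_univ m)
    have h' : C.likelihood ε m z = 0 := by
      simpa [pMZ] using h
    rw [← hm, h', hz]
    simp
  · have hp : (2 : ℝ) ^ (n - κ) ≠ 0 := by positivity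
    have term : ∀ m, (C.pMZ ε (m, z) / (C.pM ε m * C.pZ ε z) - 1) ^ 2 *
        (C.pM ε m * C.pZ ε z) =
        C.pMZ ε (m, z) * (1 / 2 ^ κ * C.baseWeight ε z / C.pZ ε z) - 2 * C.pMZ ε (m, z)
          + 1 / 2 ^ (n - κ) * C.pZ ε z := fun m => by
      rw [pM_eq]
      have hq : C.pMZ ε (m, z) = 1 / 2 ^ (n - κ) * C.likelihood ε m z := rfl
      rw [hq]
      rcases C.likelihood_eq_zero_or ε m z with h | h
      · rw [h]; simp
      · rw [← h]
        field_simp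
        ring
    rw [Finset.sum_congr rfl fun m _ => term m, Finset.sum_add_distrib, Finset.sum_sub_distrib,
      ← Finset.sum_mul, ← Finset.mul_sum]
    have hs : ∑ m, C.pMZ ε (m, z) = C.pZ ε z := rfl
    rw [hs, mul_div_cancel₀ _ hz]
    simp
    ring

lemma chiSq_eq (C : CosetCode n κ) {ε : ℝ} (h0 : 0 ≤ ε) (h1 : ε ≤ 1) :
    C.chiSq ε = C.leakage ε - 1 := by
  rw [chiSq, chiSqDiv, Fintype.sum_prod_type_right]
  simp only [C.sum_chiSq_term h0 h1]
  rw [Finset.sum_sub_distrib, sum_pZ, leakage, Finset.mul_sum]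

/-- Hamming weight of the base codeword `u G`. -/
def weight (C : CosetCode n κ) (u : Bits κ) : ℕ :=
  (Finset.univ.filter fun j => Matrix.vecMul u C.G j ≠ 0).card

lemma leakage_eq (C : CosetCode n κ) {ε : ℝ} (h1 : ε ≤ 1) :
    C.leakage ε = 1 / 2 ^ κ * ((2 - ε) ^ n * ∑ u, (ε / (2 - ε)) ^ C.weight u) := by
  have hε : 2 - ε ≠ 0 := by linarith
  rw [leakage]
  congr 1
  simp only [baseWeight]
  rw [Finset.sum_comm, Finset.mul_sum]
  refine Finset.sum_congr rfl fun u _ => ?_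
  have := (Finset.prod_univ_sum (fun _ : Fin n => (Finset.univ : Finset (Option (ZMod 2))))
    (fun j o => if o = none then ε else
      if Matrix.vecMul u C.G j = 0 then 1 - ε else 0)).symm
  rw [Fintype.piFinset_univ] at this
  rw [this]
  -- Both unerased symbols count where `uG` vanishes: `ε + 2 * (1 - ε) = 2 - ε`. Elsewhere only `ε`
  -- remains.
  have hfac : ∀ j, (∑ o : Option (ZMod 2), if o = none then ε else
      if Matrix.vecMul u C.G j = 0 then 1 - ε else 0) =
      (2 - ε) * if Matrix.vecMul u C.G j ≠ 0 then ε / (2 - ε) else 1 := fun j => by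
    rw [Fintype.sum_option]
    by_cases h : Matrix.vecMul u C.G j = 0
    · simp [h, ZMod.card]; ring
    · simp [h]; field_simp
  rw [Finset.prod_congr rfl fun j _ => hfac j, Finset.prod_mul_distrib, Finset.prod_ite]
  simp only [Finset.prod_const, Finset.card_univ, Fintype.card_fin, one_pow, mul_one, weight]

/-! ### Weights of base codewords. -/

/-- Half of all vectors are not orthogonal to a given nonzero vector. -/
lemma two_mul_card_dotProduct_ne_zero {v : Bits κ} (hv : v ≠ 0) :
    2 * (Finset.univ.filter fun u : Bits κ => u ⬝ᵥ v ≠ 0).card = 2 ^ κ := by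
  obtain ⟨i, hi⟩ := Function.ne_iff.1 hv
  have hi1 : v i = 1 := by
    have : ∀ a : ZMod 2, a ≠ 0 → a = 1 := by decide
    exact this _ hi
  have hne : ∀ a : ZMod 2, 1 + a ≠ 0 ↔ a = 0 := by decide
  -- Adding the `i`-th unit vector to `u` flips `u ⬝ᵥ v`.
  have hsw : (Finset.univ.filter fun u : Bits κ => u ⬝ᵥ v ≠ 0).card =
      (Finset.univ.filter fun u : Bits κ => ¬ u ⬝ᵥ v ≠ 0).card := by
    refine Finset.card_equiv (Equiv.addLeft (Pi.single i 1)) fun u => ?_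
    simp [add_dotProduct, hi1]
    have := hne (u ⬝ᵥ v)
    tauto
  have htot := Finset.card_filter_add_card_filter_not (s := (Finset.univ : Finset (Bits κ)))
    (fun u => u ⬝ᵥ v ≠ 0)
  rw [← hsw, Finset.card_univ] at htot
  simp [ZMod.card] at htot ⊢
  omega

lemma vecMul_eq_dotProduct_col (C : CosetCode n κ) (u : Bits κ) (j : Fin n) :
    Matrix.vecMul u C.G j = u ⬝ᵥ C.G.col j := rfl

lemma weight_zero (C : CosetCode n κ) : C.weight 0 = 0 := by
  simp [weight]

/-- Double counting by columns: a nonzero column contributes `2 ^ (κ - 1)`, a zero column nothing.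
-/
lemma two_mul_sum_weight_le (C : CosetCode n κ) : 2 * ∑ u, C.weight u ≤ n * 2 ^ κ := by
  have h : ∑ u, C.weight u =
      ∑ j, (Finset.univ.filter fun u : Bits κ => u ⬝ᵥ C.G.col j ≠ 0).card := by
    simp only [weight, vecMul_eq_dotProduct_col]
    exact Finset.sum_card_bipartiteAbove_eq_sum_card_bipartiteBelow
      (fun (u : Bits κ) (j : Fin n) => u ⬝ᵥ C.G.col j ≠ 0)
  rw [h, Finset.mul_sum]
  refine (Finset.sum_le_card_nsmul _ _ (2 ^ κ) fun j _ => ?_).trans (by simp)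
  by_cases hj : C.G.col j = 0
  · simp [hj]
  · exact (two_mul_card_dotProduct_ne_zero hj).le

lemma IsSimplex.card_col_eq {C : CosetCode n κ} (hC : C.IsSimplex) {v : Bits κ} (hv : v ≠ 0) :
    (Finset.univ.filter fun j : Fin n => C.G.col j = v).card = 1 := by
  obtain ⟨hn, h⟩ := hC
  have hκ : κ ≠ 0 := by
    rintro rfl
    exact hv (Subsingleton.elim _ _)
  have hpow : (1 : ℝ) < 2 ^ κ := one_lt_pow₀ (by norm_num) hκ
  have hnr : (n : ℝ) = 2 ^ κ - 1 := by
    rw [hn, Nat.cast_sub Nat.one_le_two_pow]; simp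
  have hv' := congrFun h v
  rw [codeVector, uniformVectorFraction, if_neg hv, hnr, div_left_inj' (by linarith)] at hv'
  exact_mod_cast hv'

/-- The columns run once through the nonzero vectors, so the weight counts the vectors not
orthogonal to `u`. -/
lemma IsSimplex.two_mul_weight {C : CosetCode n κ} (hC : C.IsSimplex) {u : Bits κ} (hu : u ≠ 0) :
    2 * C.weight u = 2 ^ κ := by
  have h : C.weight u = (Finset.univ.filter fun v : Bits κ => v ⬝ᵥ u ≠ 0).card := by
    refine Finset.card_bij (fun j _ => C.G.col j) ?_ ?_ ?_
    · intro j hj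
      simpa [vecMul_eq_dotProduct_col, dotProduct_comm u] using hj
    · intro j hj j' hj' he
      have hne : C.G.col j' ≠ 0 := by
        intro h0
        rw [Finset.mem_filter, vecMul_eq_dotProduct_col, h0, dotProduct_zero] at hj'
        exact hj'.2 rfl
      exact Finset.card_le_one.1 (hC.card_col_eq hne).le j (by simpa using he) j' (by simp)
    · intro v hv
      have hv0 : v ≠ 0 := by
        rintro rfl
        simp at hv
      obtain ⟨j, hj⟩ := Finset.card_eq_one.1 (hC.card_col_eq hv0)
      have hj' : C.G.col j = v := by
        have : j ∈ Finset.univ.filter fun j : Fin n => C.G.col j = v := by simp [hj]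
        simpa using this
      refine ⟨j, ?_, hj'⟩
      simpa [vecMul_eq_dotProduct_col, hj', dotProduct_comm u] using hv
  rw [h, two_mul_card_dotProduct_ne_zero hu]

/-! ### Convexity and optimality. -/

/-- The exponential sequence `a ^ w` lies above the extension of each of its chords of unit length. -/
lemma pow_succ_add_mul_le_pow {a : ℝ} (h0 : 0 ≤ a) (W w : ℕ) :
    a ^ (W + 1) + ((w : ℝ) - (W + 1)) * (a ^ (W + 1) - a ^ W) ≤ a ^ w := by
  have hb : ∀ d : ℕ, 1 + d * (a - 1) ≤ a ^ d := fun d => by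
    have := one_add_mul_le_pow (a := a - 1) (by linarith) d
    simpa using this
  rcases le_total W w with h | h
  · obtain ⟨d, rfl⟩ := Nat.exists_eq_add_of_le h
    have := mul_le_mul_of_nonneg_left (hb d) (pow_nonneg h0 W)
    rw [pow_add a W d, pow_succ a W]
    push_cast
    linear_combination this
  · obtain ⟨d, rfl⟩ := Nat.exists_eq_add_of_le h
    have hd : a ^ d * (1 + d * (1 - a)) ≤ 1 := by
      induction d with
      | zero => simp
      | succ d ih =>
        have ih := ih (by omega)
        have hp := pow_nonneg h0 d
        -- This is exactly the decrease of the left side from `d` to `d + 1`.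
        have : 0 ≤ a ^ d * ((1 - a) ^ 2 * (d + 1)) := by positivity
        rw [pow_succ]
        push_cast
        nlinarith
    have := mul_le_mul_of_nonneg_left hd (pow_nonneg h0 w)
    rw [pow_succ a (w + d), pow_add a w d]
    push_cast
    linear_combination this

lemma IsSimplex.sum_pow_weight_le {S : CosetCode n κ} (hS : S.IsSimplex) (hκ : 1 ≤ κ)
    (C : CosetCode n κ) {a : ℝ} (h0 : 0 ≤ a) (h1 : a ≤ 1) :
    ∑ u, a ^ S.weight u ≤ ∑ u, a ^ C.weight u := by
  obtain ⟨W, hW⟩ : ∃ W, 2 * (W + 1) = 2 ^ κ := by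
    obtain ⟨k, rfl⟩ := Nat.exists_eq_add_of_le' hκ
    have : 0 < 2 ^ k := by positivity
    exact ⟨2 ^ k - 1, by rw [pow_succ]; omega⟩
  -- Chord through `W` and `W + 1 = 2 ^ (κ - 1)`, the simplex weight; at `u = 0` both weights
  -- vanish.
  have hpt : ∀ u, a ^ S.weight u +
      ((C.weight u : ℝ) - if u = 0 then 0 else ((W : ℝ) + 1)) * (a ^ (W + 1) - a ^ W) ≤
      a ^ C.weight u := fun u => by
    by_cases hu : u = 0
    · simp [hu, weight_zero]
    · have : S.weight u = W + 1 := by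
        have := hS.two_mul_weight hu
        omega
      rw [this, if_neg hu]
      exact pow_succ_add_mul_le_pow h0 W _
  have hsum := Finset.sum_le_sum fun u (_ : u ∈ Finset.univ) => hpt u
  rw [Finset.sum_add_distrib, ← Finset.sum_mul, Finset.sum_sub_distrib] at hsum
  have hite : ∑ u : Bits κ, (if u = 0 then (0 : ℝ) else (W : ℝ) + 1) = n * (W + 1) := by
    rw [hS.1, Finset.sum_ite]
    simp [Finset.filter_ne', Finset.card_erase_of_mem, ZMod.card]
    ring
  have hC : (2 : ℝ) * ∑ u, (C.weight u : ℝ) ≤ n * (2 * (W + 1)) := by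
    have := C.two_mul_sum_weight_le
    rw [← hW] at this
    exact_mod_cast this
  have hneg : a ^ (W + 1) - a ^ W ≤ 0 := sub_nonpos.2 (pow_le_pow_of_le_one h0 h1 (Nat.le_succ W))
  rw [hite] at hsum
  have := mul_nonneg_of_nonpos_of_nonpos
    (show ∑ u, (C.weight u : ℝ) - n * (W + 1) ≤ 0 by linarith) hneg
  linarith

lemma IsSimplex.leakage_le {S : CosetCode n κ} (hS : S.IsSimplex) (hκ : 1 ≤ κ)
    (C : CosetCode n κ) {ε : ℝ} (h0 : 0 ≤ ε) (h1 : ε ≤ 1) : S.leakage ε ≤ C.leakage ε := by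
  have h2 : 0 < 2 - ε := by linarith
  rw [S.leakage_eq h1, C.leakage_eq h1]
  have h := hS.sum_pow_weight_le hκ C (div_nonneg h0 h2.le) ((div_le_one h2).2 (by linarith))
  exact mul_le_mul_of_nonneg_left (mul_le_mul_of_nonneg_left h (by positivity)) (by positivity)

/-! ### Existence of simplex codes. -/

/-- A base code matrix with independent rows extends to a coset code. -/
lemma exists_of_linearIndependent (G : Matrix (Fin κ) (Fin n) (ZMod 2))
    (hG : LinearIndependent (ZMod 2) G.row) : ∃ C : CosetCode n κ, C.G = G := by
  obtain ⟨U, hU⟩ := Submodule.exists_isCompl (Submodule.span (ZMod 2) (Set.range G.row))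
  have hrank : Module.finrank (ZMod 2) U = n - κ := by
    have h := Submodule.finrank_add_eq_of_isCompl hU
    rw [finrank_span_eq_card hG] at h
    simp only [Fintype.card_fin, Module.finrank_fin_fun] at h
    omega
  let b := Module.finBasisOfFinrankEq (ZMod 2) U hrank
  refine ⟨⟨G, Matrix.of fun i => (b i : Bits n), ?_⟩, rfl⟩
  have hb : LinearIndependent (ZMod 2) fun i => (b i : Bits n) :=
    b.linearIndependent.map' U.subtype U.ker_subtype
  have hle : Submodule.span (ZMod 2) (Set.range fun i => (b i : Bits n)) ≤ U := by
    rw [Submodule.span_le]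
    rintro _ ⟨i, rfl⟩
    exact (b i).2
  have h := hb.sum_type hG (hU.disjoint.symm.mono_left hle)
  have hrow : (Matrix.fromRows (Matrix.of fun i => (b i : Bits n)) G).row =
      Sum.elim (fun i => (b i : Bits n)) G.row := by
    ext i
    cases i <;> rfl
  rw [hrow]
  exact h

lemma exists_isSimplex (κ : ℕ) : ∃ S : CosetCode (2 ^ κ - 1) κ, S.IsSimplex := by
  have hcard : Fintype.card {v : Bits κ // v ≠ 0} = 2 ^ κ - 1 := by
    rw [Fintype.card_subtype_compl]
    simp [ZMod.card]
  let e : Fin (2 ^ κ - 1) ≃ {v : Bits κ // v ≠ 0} := (Fintype.equivFinOfCardEq hcard).symm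
  let G : Matrix (Fin κ) (Fin (2 ^ κ - 1)) (ZMod 2) := Matrix.of fun i j => (e j : Bits κ) i
  have hG : LinearIndependent (ZMod 2) G.row := by
    rw [Fintype.linearIndependent_iff]
    intro c hc i
    -- The column equal to the `i`-th unit vector isolates the coefficient `c i`.
    have hs : (Pi.single i 1 : Bits κ) ≠ 0 := by simp
    have := congrFun hc (e.symm ⟨Pi.single i 1, hs⟩)
    simpa [G, Finset.sum_apply, Pi.single_apply] using this
  obtain ⟨S, hS⟩ := exists_of_linearIndependent G hG
  refine ⟨S, rfl, ?_⟩
  ext v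
  have hcol : ∀ j, S.G.col j = (e j : Bits κ) := fun j => by rw [hS]; rfl
  simp only [codeVector, uniformVectorFraction, hcol]
  split_ifs with hv
  · simp [hv, (e _).2]
  · have : (Finset.univ.filter fun j => (e j : Bits κ) = v) = {e.symm ⟨v, hv⟩} := by
      ext j
      simp [Equiv.eq_symm_apply, Subtype.ext_iff]
    rw [this, Nat.cast_sub Nat.one_le_two_pow]
    simp

end CosetCode

end BEWC

theorem corollary3 (κ : ℕ) (hκ : 1 ≤ κ) :
    (∃ S : BEWC.CosetCode (2 ^ κ - 1) κ, S.IsSimplex) ∧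
    ∀ S : BEWC.CosetCode (2 ^ κ - 1) κ, S.IsSimplex →
      ∀ C : BEWC.CosetCode (2 ^ κ - 1) κ, ∀ ε : ℝ, 0 ≤ ε → ε ≤ 1 →
        S.chiSq ε ≤ C.chiSq ε ∧
        ∀ (dS dC : BEWC.Obs (2 ^ κ - 1) → BEWC.Bits (2 ^ κ - 1 - κ)),
          S.IsMLDecoder ε dS → C.IsMLDecoder ε dC →
            S.successProb ε dS ≤ C.successProb ε dC := by
  refine ⟨BEWC.CosetCode.exists_isSimplex κ, fun S hS C ε h0 h1 => ?_⟩
  have h := hS.leakage_le hκ C h0 h1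
  refine ⟨?_, fun dS dC hdS hdC => ?_⟩
  · rw [S.chiSq_eq h0 h1, C.chiSq_eq h0 h1]
    linarith
  · rw [S.successProb_eq h0 h1 hdS, C.successProb_eq h0 h1 hdC]
    gcongr
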